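/- For real matrices, $\|\cdot\|$ denotes the operator norm induced by the Euclidean norms, and $\mathbb{R}^m_{++}$ denotes the set of vectors in $\mathbb{R}^m$ with all entries positive. For $A\in\mathbb{R}^{m\times n}$ put $A(\mathbb{R}^n)=\{Ax : x\in\mathbb{R}^n\}$ and \[ \mathcal{R}(A):=\inf\{\|\Delta A\| : \Delta A\in\mathbb{R}^{m\times n},\ (A+\Delta A)(\mathbb{R}^n)\cap\mathbb{R}^m_{++}=\emptyset\}. \] For linear subspaces $L,L'\subseteq\mathbb{R}^m$ of the same dimension put $\mathrm{dist}(L,L'):=\|\Pi_L-\Pi_{L'}\|$, where $\Pi_L,\Pi_{L'}$ are the orthogonal projections onto $L$ and $L'$. With $L:=A(\mathbb{R}^n)$, define \[ \mathcal{G}(A):=\frac{1}{\min\{\mathrm{dist}(L,L') : L'\subseteq\mathbb{R}^m \text{ a linear subspace},\ \dim L'=\dim L,\ L'\cap\mathbb{R}^m_{++}=\emptyset\}}. \] Suppose that $A\in\mathbb{R}^{m\times n}$ is nonzero, that $A(\mathbb{R}^n)\cap\mathbb{R}^m_{++}\neq\emptyset$, and that $A(\mathbb{R}^n)\neq\mathbb{R}^m$.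 Then $\mathcal{R}(A)>0$, the minimum in the definition of $\mathcal{G}(A)$ is attained and positive, and \[ \mathcal{G}(A)\le\frac{\|A\|}{\mathcal{R}(A)}, \] and $\mathcal{G}(A)=1/\mathcal{R}(A)$ whenever the nonzero columns of $A$ are orthonormal. Furthermore, \[ \mathcal{G}(A)=\min_{R\in\mathbb{R}^{n\times n}\ \text{nonsingular}}\frac{\|AR\|}{\mathcal{R}(AR)}, \] where the minimum is attained. -/

import Mathlib

-- `‖A‖` for a real matrix `A` is the operator norm for the Euclidean norms.
open scoped Matrix.Norms.L2Operator

noncomputable section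

/-- The open positive orthant of `ℝᵐ`. -/
def posOrthant (m : ℕ) : Set (EuclideanSpace ℝ (Fin m)) :=
  {y | ∀ i, 0 < y i}

/-- The subspace `A(ℝⁿ) = {A x : x ∈ ℝⁿ}` of `ℝᵐ`. -/
def imageSpace {m n : ℕ} (A : Matrix (Fin m) (Fin n) ℝ) :
    Submodule ℝ (EuclideanSpace ℝ (Fin m)) :=
  LinearMap.range (Matrix.toEuclideanLin A)

/-- Renegar's distance to infeasibility: the infimum of `‖ΔA‖` over all `ΔA` such that
`(A + ΔA)(ℝⁿ)` does not meet the open positive orthant. -/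
def renegarDist {m n : ℕ} (A : Matrix (Fin m) (Fin n) ℝ) : ℝ :=
  sInf {r : ℝ | ∃ Δ : Matrix (Fin m) (Fin n) ℝ,
    (imageSpace (A + Δ) : Set (EuclideanSpace ℝ (Fin m))) ∩ posOrthant m = ∅ ∧ r = ‖Δ‖}

/-- The Grassmannian distance `‖Π_L - Π_L'‖` (operator norm of the difference of the orthogonal
projections). -/
def grassmannDist {m : ℕ} (L L' : Submodule ℝ (EuclideanSpace ℝ (Fin m))) : ℝ :=
  ‖L.starProjection - L'.starProjection‖

/-- The Grassmannian distances from `L` to the subspaces `L'` of the same dimension that do not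
meet the open positive orthant. -/
def infeasibleDistances {m : ℕ} (L : Submodule ℝ (EuclideanSpace ℝ (Fin m))) : Set ℝ :=
  {r : ℝ | ∃ L' : Submodule ℝ (EuclideanSpace ℝ (Fin m)),
    Module.finrank ℝ L' = Module.finrank ℝ L ∧
    (L' : Set (EuclideanSpace ℝ (Fin m))) ∩ posOrthant m = ∅ ∧ r = grassmannDist L L'}

/-- The Grassmannian condition number of `A`: the reciprocal of the least element of
`infeasibleDistances (A(ℝⁿ))`. -/
def grassmannCond {m n : ℕ} (A : Matrix (Fin m) (Fin n) ℝ) : ℝ :=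
  1 / sInf (infeasibleDistances (imageSpace A))

end

/-! Both distances are minima over the same compact set, the nonnegative unit vectors `v`. By
Gordan's alternative a subspace misses the open orthant exactly when such a `v` is normal to it. For
a fixed `v`, the cheapest perturbation making the image normal to `v` has norm `‖Aᵀ v‖`
(`exists_renegarDist_eq`), and the nearest subspace of equal dimension normal to `v` lies at
distance `‖Π_L v‖` (`exists_isLeast_infeasibleDistances`).

Since `Aᵀ v = Aᵀ Π_L v`, the first quantity is at most `‖A‖` times the second, which is the
inequality. If the nonzero columns are orthonormal, then `A Aᵀ = Π_L`, so the two quantities agree.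
A nonsingular `R` preserves the image, and some `R` makes the nonzero columns of `A R` orthonormal,
with `‖A R‖ ≤ 1`; this attains the minimum. -/

open scoped InnerProductSpace

/-! ### Separation from the positive orthant -/

section Orthant

variable {m : ℕ}

lemma isOpen_posOrthant : IsOpen (posOrthant m) := by
  have : posOrthant m = ⋂ i, {y | 0 < y i} := by ext; simp [posOrthant]
  rw [this]
  exact isOpen_iInter_of_finite fun i => isOpen_lt continuous_const (by fun_prop)

lemma convex_posOrthant : Convex ℝ (posOrthant m) := by
  intro x hx y hy a b ha hb hab i
  have hxi := hx i
  have hyi := hy i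
  simp only [PiLp.add_apply, PiLp.smul_apply, smul_eq_mul]
  rcases ha.eq_or_lt with rfl | ha
  · have : b = 1 := by linarith
    subst this; simpa using hyi
  · have := mul_pos ha hxi
    have := mul_nonneg hb hyi.le
    linarith

/-- The unit vectors with nonnegative entries. -/
def nonnegSphere (m : ℕ) : Set (EuclideanSpace ℝ (Fin m)) :=
  {v | ‖v‖ = 1 ∧ ∀ i, 0 ≤ v i}

lemma isCompact_nonnegSphere : IsCompact (nonnegSphere m) := by
  have h : nonnegSphere m = Metric.sphere 0 1 ∩ ⋂ i, {v | 0 ≤ v i} := by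
    ext; simp [nonnegSphere]
  rw [h]
  exact (isCompact_sphere _ _).inter_right
    (isClosed_iInter fun i => isClosed_le continuous_const (by fun_prop))

lemma nonnegSphere_nonempty (hm : 0 < m) : (nonnegSphere m).Nonempty := by
  refine ⟨EuclideanSpace.single ⟨0, hm⟩ 1, by simp, fun i => ?_⟩
  by_cases h : i = ⟨0, hm⟩ <;> simp [h]

lemma inner_pos_of_mem_nonnegSphere {v y : EuclideanSpace ℝ (Fin m)}
    (hv : v ∈ nonnegSphere m) (hy : y ∈ posOrthant m) : 0 < ⟪v, y⟫_ℝ := by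
  have hne : ∃ i, v i ≠ 0 := by
    by_contra! h
    have h0 : v = 0 := by ext i; simpa using h i
    simpa [h0] using hv.1
  obtain ⟨i, hi⟩ := hne
  rw [PiLp.inner_apply]
  refine Finset.sum_pos' (fun j _ => ?_) ⟨i, Finset.mem_univ i, ?_⟩
  · simpa using mul_nonneg (hy j).le (hv.2 j)
  · simpa using mul_pos (hy i) (lt_of_le_of_ne (hv.2 i) hi.symm)

lemma inter_posOrthant_eq_empty_of_orthogonal {L : Submodule ℝ (EuclideanSpace ℝ (Fin m))}
    {v : EuclideanSpace ℝ (Fin m)} (hv : v ∈ nonnegSphere m) (h : v ∈ Lᗮ) :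
    (L : Set (EuclideanSpace ℝ (Fin m))) ∩ posOrthant m = ∅ := by
  refine Set.eq_empty_of_forall_notMem fun y hy => ?_
  have h1 := inner_pos_of_mem_nonnegSphere hv hy.2
  rw [L.inner_left_of_mem_orthogonal hy.1 h] at h1
  exact lt_irrefl _ h1

/-- Gordan's alternative: a subspace missing the open positive orthant has a nonnegative unit
normal vector. -/
lemma exists_mem_nonnegSphere_orthogonal
    {L : Submodule ℝ (EuclideanSpace ℝ (Fin m))}
    (h : (L : Set (EuclideanSpace ℝ (Fin m))) ∩ posOrthant m = ∅) :
    ∃ v ∈ nonnegSphere m, v ∈ Lᗮ := by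
  obtain ⟨f, u, hP, hL⟩ := geometric_hahn_banach_open convex_posOrthant isOpen_posOrthant
    L.convex (Set.disjoint_iff_inter_eq_empty.2 (Set.inter_comm _ _ ▸ h))
  have hu : u ≤ 0 := by simpa using hL 0 L.zero_mem
  have hfL : ∀ x ∈ L, f x = 0 := by
    intro x hx
    by_contra hne
    -- `f` is bounded below by `u` on `L`; this multiple of `x` would take the value `u - 1`.
    have := hL (((u - 1) / f x) • x) (L.smul_mem _ hx)
    rw [map_smul, smul_eq_mul, div_mul_cancel₀ _ hne] at this
    linarith
  set w := (InnerProductSpace.toDual ℝ (EuclideanSpace ℝ (Fin m))).symm f with hw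
  have hwf : ∀ x, ⟪w, x⟫_ℝ = f x := fun x => InnerProductSpace.toDual_symm_apply
  let o : EuclideanSpace ℝ (Fin m) := WithLp.toLp 2 fun _ => 1
  have ho : f o < 0 := (hP o fun i => by simp [o]).trans_le hu
  have hw0 : w ≠ 0 := by
    intro h0
    rw [← hwf, h0, inner_zero_left] at ho
    exact lt_irrefl _ ho
  have hwi : ∀ i, w i ≤ 0 := by
    intro i
    have h1 : w i = f (EuclideanSpace.single i 1) := by
      rw [← hwf, EuclideanSpace.inner_single_right]; simp
    by_contra! hpos
    rw [h1] at hpos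
    set t := f (EuclideanSpace.single i (1 : ℝ))
    -- The coefficient makes `f` vanish at a point of the orthant, where `f` is negative.
    have h2 := (hP (o + (-(f o) / t) • EuclideanSpace.single i 1) fun j => by
      have h3 : 0 ≤ -(f o) / t := div_nonneg (by linarith) hpos.le
      by_cases hj : j = i
      · subst hj; simp [o]; linarith
      · simp [o, hj]).trans_le hu
    rw [map_add, map_smul, smul_eq_mul] at h2
    change f o + -(f o) / t * t < 0 at h2
    rw [div_mul_cancel₀ _ hpos.ne'] at h2
    linarith
  have hn : 0 < ‖w‖ := norm_pos_iff.2 hw0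
  refine ⟨(-‖w‖⁻¹) • w, ⟨?_, fun i => ?_⟩, ?_⟩
  · rw [norm_smul, norm_neg, norm_inv, norm_norm, inv_mul_cancel₀ hn.ne']
  · simpa using mul_nonneg_of_nonpos_of_nonpos (neg_nonpos.2 (inv_nonneg.2 hn.le)) (hwi i)
  · refine Submodule.smul_mem _ _ ((Submodule.mem_orthogonal' _ _).2 fun x hx => ?_)
    rw [hwf, hfL x hx]

end Orthant

/-! ### Distances between orthogonal projections -/

section Projections

variable {E : Type*} [NormedAddCommGroup E] [InnerProductSpace ℝ E]

/-- The distance between two projections is controlled by how far each subspace is from the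
other. -/
lemma norm_starProjection_sub_le (K L : Submodule ℝ E) [K.HasOrthogonalProjection]
    [L.HasOrthogonalProjection] {s : ℝ} (hs : 0 ≤ s)
    (hKL : ∀ x ∈ K, ‖x - L.starProjection x‖ ≤ s * ‖x‖)
    (hLK : ∀ x ∈ L, ‖x - K.starProjection x‖ ≤ s * ‖x‖) :
    ‖K.starProjection - L.starProjection‖ ≤ s := by
  refine ContinuousLinearMap.opNorm_le_bound _ hs fun x => ?_
  set P := K.starProjection
  set Q := L.starProjection
  -- `(P - Q) x = a - b` with `a ∈ K` and `b ∈ Kᗮ`, so the two parts are bounded separately and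
  -- recombined by Pythagoras.
  set a := P (x - Q x) with ha
  set b := Q x - P (Q x) with hb
  have hPa : P a = a := K.starProjection_eq_self_iff.2 (K.starProjection_apply_mem _)
  have hsplit : (P - Q) x = a - b := by
    simp only [ha, hb, sub_apply, map_sub]; abel
  have hort : ⟪a, b⟫_ℝ = 0 := by
    rw [real_inner_comm]
    exact K.starProjection_inner_eq_zero _ _ (K.starProjection_apply_mem _)
  have hbn : ‖b‖ ≤ s * ‖Q x‖ := hLK _ (L.starProjection_apply_mem _)
  have han : ‖a‖ ≤ s * ‖x - Q x‖ := by
    -- As `x - Q x` is orthogonal to `L`, subtracting `Q a` is free; this brings in `hKL` at `a`.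
    have h1 : ‖a‖ * ‖a‖ = ⟪x - Q x, a - Q a⟫_ℝ := by
      rw [← real_inner_self_eq_norm_mul_norm]
      have h2 : ⟪a, a⟫_ℝ = ⟪x - Q x, P a⟫_ℝ := K.inner_starProjection_left_eq_right _ _
      rw [h2, hPa, inner_sub_right,
        L.starProjection_inner_eq_zero x (Q a) (L.starProjection_apply_mem _), sub_zero]
    have h3 : ‖a‖ * ‖a‖ ≤ (s * ‖x - Q x‖) * ‖a‖ := by
      rw [h1]
      calc _ ≤ ‖x - Q x‖ * ‖a - Q a‖ := real_inner_le_norm _ _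
        _ ≤ ‖x - Q x‖ * (s * ‖a‖) :=
          mul_le_mul_of_nonneg_left (hKL _ (K.starProjection_apply_mem _)) (norm_nonneg _)
        _ = _ := by ring
    rcases (norm_nonneg a).eq_or_lt with h0 | h0
    · rw [← h0]; positivity
    · exact le_of_mul_le_mul_right h3 h0
  have hpy : ‖x‖ * ‖x‖ = ‖x - Q x‖ * ‖x - Q x‖ + ‖Q x‖ * ‖Q x‖ := by
    conv_lhs => rw [← sub_add_cancel x (Q x)]
    exact norm_add_sq_eq_norm_sq_add_norm_sq_real
      (L.starProjection_inner_eq_zero _ _ (L.starProjection_apply_mem _))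
  have hpy2 : ‖a - b‖ * ‖a - b‖ = ‖a‖ * ‖a‖ + ‖b‖ * ‖b‖ :=
    norm_sub_sq_eq_norm_sq_add_norm_sq_real hort
  rw [hsplit]
  refine abs_le_of_sq_le_sq' ?_ (by positivity) |>.2
  have h4 := mul_self_le_mul_self (norm_nonneg _) han
  have h5 := mul_self_le_mul_self (norm_nonneg _) hbn
  calc ‖a - b‖ ^ 2 = ‖a‖ * ‖a‖ + ‖b‖ * ‖b‖ := by rw [sq, hpy2]
    _ ≤ s * ‖x - Q x‖ * (s * ‖x - Q x‖) + s * ‖Q x‖ * (s * ‖Q x‖) := add_le_add h4 h5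
    _ = s * s * (‖x - Q x‖ * ‖x - Q x‖ + ‖Q x‖ * ‖Q x‖) := by ring
    _ = (s * ‖x‖) ^ 2 := by rw [← hpy]; ring

lemma norm_sub_starProjection_le (K : Submodule ℝ E) [K.HasOrthogonalProjection] (x : E)
    {y : E} (hy : y ∈ K) : ‖x - K.starProjection x‖ ≤ ‖x - y‖ := by
  rw [K.starProjection_minimal]
  exact ciInf_le ⟨0, by rintro _ ⟨z, rfl⟩; positivity⟩ (⟨y, hy⟩ : K)

lemma norm_starProjection_sub_le_one (K L : Submodule ℝ E) [K.HasOrthogonalProjection]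
    [L.HasOrthogonalProjection] : ‖K.starProjection - L.starProjection‖ ≤ 1 := by
  refine norm_starProjection_sub_le K L zero_le_one (fun x _ => ?_) (fun x _ => ?_)
  · simpa using norm_sub_starProjection_le L x L.zero_mem
  · simpa using norm_sub_starProjection_le K x K.zero_mem

/-- Evaluate the difference at `v`, which `Π_L` kills. With Gordan's alternative this is the lower
bound on the distance to an infeasible subspace. -/
lemma norm_starProjection_apply_le_norm_sub (K L : Submodule ℝ E) [K.HasOrthogonalProjection]
    [L.HasOrthogonalProjection] {v : E} (hv : ‖v‖ = 1) (hvL : v ∈ Lᗮ) :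
    ‖K.starProjection v‖ ≤ ‖K.starProjection - L.starProjection‖ := by
  have h := (K.starProjection - L.starProjection).le_opNorm v
  rwa [sub_apply, L.starProjection_apply_eq_zero_iff.2 hvL, sub_zero, hv,
    mul_one] at h

lemma exists_submodule_le_finrank_eq [FiniteDimensional ℝ E] (M : Submodule ℝ E) {k : ℕ}
    (hk : k ≤ Module.finrank ℝ M) : ∃ N ≤ M, Module.finrank ℝ N = k := by
  obtain ⟨f, hf⟩ := exists_linearIndependent_of_le_finrank hk
  refine ⟨(Submodule.span ℝ (Set.range f)).map M.subtype, Submodule.map_subtype_le _ _, ?_⟩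
  rw [(Submodule.equivMapOfInjective _ M.injective_subtype _).finrank_eq.symm, finrank_span_eq_card hf,
    Fintype.card_fin]

/-- Among the subspaces of dimension `dim L` orthogonal to a unit vector `v`, some subspace has
distance at most `‖Π_L v‖` from `L`. -/
lemma exists_orthogonal_norm_starProjection_sub_le [FiniteDimensional ℝ E] {L : Submodule ℝ E}
    (hL : L ≠ ⊤) {v : E} (hv : ‖v‖ = 1) :
    ∃ L' : Submodule ℝ E, Module.finrank ℝ L' = Module.finrank ℝ L ∧ v ∈ L'ᗮ ∧
      ‖L.starProjection - L'.starProjection‖ ≤ ‖L.starProjection v‖ := by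
  -- If `v ∈ L`, then `‖Π_L v‖ = 1` bounds every distance, and any subspace of `vᗮ` of the right
  -- dimension serves; one exists because `L ≠ ⊤`.
  by_cases hvL : v ∈ L
  · have hk : Module.finrank ℝ L ≤ Module.finrank ℝ (ℝ ∙ v)ᗮ := by
      have h1 := Submodule.finrank_lt hL
      have h2 := (ℝ ∙ v).finrank_add_finrank_orthogonal
      rw [finrank_span_singleton (by rintro rfl; simp at hv)] at h2
      omega
    obtain ⟨N, hN, hNk⟩ := exists_submodule_le_finrank_eq _ hk
    refine ⟨N, hNk, ?_, ?_⟩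
    · exact Submodule.orthogonal_le hN
        (Submodule.le_orthogonal_orthogonal _ (Submodule.mem_span_singleton_self v))
    · rw [L.starProjection_eq_self_iff.2 hvL, hv]
      exact norm_starProjection_sub_le_one _ _
  · set p := L.starProjection v with hp
    -- The projection onto `vᗮ`. Its kernel is the line of `v`, which meets `L` only in zero, so
    -- `L.map φ` keeps the dimension of `L`.
    let φ : E →ₗ[ℝ] E := LinearMap.id - (innerₛₗ ℝ v).smulRight v
    have hφ : ∀ x, φ x = x - ⟪v, x⟫_ℝ • v := fun x => rfl
    have hvv : ⟪v, v⟫_ℝ = 1 := by rw [real_inner_self_eq_norm_sq, hv]; norm_num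
    have hpx : ∀ x ∈ L, |⟪v, x⟫_ℝ| ≤ ‖p‖ * ‖x‖ := by
      intro x hx
      have h : ⟪v, x⟫_ℝ = ⟪p, x⟫_ℝ := by
        have := L.starProjection_inner_eq_zero v x hx
        rw [inner_sub_left] at this
        linarith
      rw [h]
      exact abs_real_inner_le_norm _ _
    refine ⟨L.map φ, ?_, ?_, ?_⟩
    · have hinj : Function.Injective (φ.domRestrict L) := by
        rw [← LinearMap.ker_eq_bot, LinearMap.ker_eq_bot']
        rintro ⟨x, hx⟩ h0
        have h1 : x = ⟪v, x⟫_ℝ • v := sub_eq_zero.1 h0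
        by_cases hc : ⟪v, x⟫_ℝ = 0
        · exact Subtype.ext (by simpa [hc] using h1)
        · refine absurd ?_ hvL
          have : v = (⟪v, x⟫_ℝ)⁻¹ • x := by
            conv_rhs => rw [h1, inner_smul_right, hvv, mul_one]
            rw [smul_smul, inv_mul_cancel₀ hc, one_smul]
          rw [this]
          exact L.smul_mem _ hx
      rw [← LinearMap.range_domRestrict]
      exact LinearMap.finrank_range_of_inj hinj
    · rw [Submodule.mem_orthogonal']
      rintro _ ⟨x, -, rfl⟩
      rw [hφ, inner_sub_right, inner_smul_right, hvv, mul_one, sub_self]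
    · refine norm_starProjection_sub_le _ _ (norm_nonneg _) (fun x hx => ?_) ?_
      · refine (norm_sub_starProjection_le _ x (Submodule.mem_map_of_mem hx)).trans ?_
        rw [hφ, sub_sub_cancel, norm_smul, hv, mul_one]
        exact hpx x hx
      · rintro _ ⟨x, hx, rfl⟩
        set c := ⟪v, x⟫_ℝ with hc
        have h1 : φ x - L.starProjection (φ x) = -c • (v - p) := by
          rw [hφ, map_sub, map_smul, L.starProjection_eq_self_iff.2 hx, ← hp, ← hc]
          module
        have h2 : ‖v - p‖ ^ 2 = 1 - ‖p‖ ^ 2 := by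
          have : ‖v - p‖ ^ 2 + ‖p‖ ^ 2 = ‖v‖ ^ 2 := by
            conv_rhs => rw [← sub_add_cancel v p]
            have := norm_add_sq_eq_norm_sq_add_norm_sq_real
              (L.starProjection_inner_eq_zero v p (L.starProjection_apply_mem _))
            simp only [sq]
            exact this.symm
          rw [hv] at this
          linarith
        have h3 : ‖φ x‖ ^ 2 = ‖x‖ ^ 2 - c ^ 2 := by
          rw [hφ, norm_sub_sq_real, inner_smul_right, real_inner_comm v x, ← hc, norm_smul, hv,
            Real.norm_eq_abs, mul_one, sq_abs]
          ring
        have h4 : c ^ 2 ≤ (‖p‖ * ‖x‖) ^ 2 := sq_le_sq.2 ((hpx x hx).trans (le_abs_self _))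
        rw [h1]
        refine abs_le_of_sq_le_sq' ?_ (by positivity) |>.2
        rw [norm_smul, norm_neg, Real.norm_eq_abs, mul_pow, sq_abs, h2, mul_pow, h3]
        -- The goal `c² (1 - ‖p‖²) ≤ ‖p‖² (‖x‖² - c²)` is `h4` once `c² ‖p‖²` cancels.
        nlinarith

end Projections

/-! ### Both distances as minima over nonnegative unit vectors -/

section Distances

variable {m n : ℕ}

lemma norm_starProjection_pos {L : Submodule ℝ (EuclideanSpace ℝ (Fin m))}
    (hpos : ((L : Set (EuclideanSpace ℝ (Fin m))) ∩ posOrthant m).Nonempty)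
    {v : EuclideanSpace ℝ (Fin m)} (hv : v ∈ nonnegSphere m) : 0 < ‖L.starProjection v‖ := by
  refine norm_pos_iff.2 fun h => hpos.ne_empty ?_
  exact inter_posOrthant_eq_empty_of_orthogonal hv (L.starProjection_apply_eq_zero_iff.1 h)

/-- The distance of `L` to the infeasible subspaces is attained, and it is the least norm of
`Π_L v` over the nonnegative unit vectors `v`. -/
lemma exists_isLeast_infeasibleDistances (hm : 0 < m)
    {L : Submodule ℝ (EuclideanSpace ℝ (Fin m))} (hL : L ≠ ⊤) :
    ∃ v ∈ nonnegSphere m, (∀ w ∈ nonnegSphere m, ‖L.starProjection v‖ ≤ ‖L.starProjection w‖) ∧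
      IsLeast (infeasibleDistances L) ‖L.starProjection v‖ := by
  obtain ⟨v, hv, hmin⟩ := isCompact_nonnegSphere.exists_isMinOn (nonnegSphere_nonempty hm)
    (f := fun v => ‖L.starProjection v‖) (by fun_prop)
  refine ⟨v, hv, fun w hw => hmin hw, ?_, ?_⟩
  · obtain ⟨L', hk, hvL', hle⟩ := exists_orthogonal_norm_starProjection_sub_le hL hv.1
    exact ⟨L', hk, inter_posOrthant_eq_empty_of_orthogonal hv hvL',
      (norm_starProjection_apply_le_norm_sub L L' hv.1 hvL').antisymm hle⟩
  · rintro _ ⟨L', -, hL', rfl⟩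
    obtain ⟨w, hw, hwL'⟩ := exists_mem_nonnegSphere_orthogonal hL'
    exact (hmin hw).trans (norm_starProjection_apply_le_norm_sub L L' hw.1 hwL')

/-- The adjoint of a real matrix acting on Euclidean space. -/
lemma inner_toEuclideanLin_transpose (A : Matrix (Fin m) (Fin n) ℝ)
    (v : EuclideanSpace ℝ (Fin m)) (x : EuclideanSpace ℝ (Fin n)) :
    ⟪A.transpose.toEuclideanLin v, x⟫_ℝ = ⟪v, A.toEuclideanLin x⟫_ℝ := by
  rw [← Matrix.conjTranspose_eq_transpose_of_trivial, Matrix.toEuclideanLin_conjTranspose_eq_adjoint,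
    LinearMap.adjoint_inner_left]

lemma mem_orthogonal_imageSpace_iff (A : Matrix (Fin m) (Fin n) ℝ)
    (v : EuclideanSpace ℝ (Fin m)) :
    v ∈ (imageSpace A)ᗮ ↔ A.transpose.toEuclideanLin v = 0 := by
  rw [Submodule.mem_orthogonal']
  constructor
  · intro h
    rw [← inner_self_eq_zero (𝕜 := ℝ), inner_toEuclideanLin_transpose]
    exact h _ ⟨_, rfl⟩
  · rintro h _ ⟨x, rfl⟩
    rw [← inner_toEuclideanLin_transpose, h, inner_zero_left]

lemma norm_toEuclideanLin_transpose_le (A : Matrix (Fin m) (Fin n) ℝ)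
    (v : EuclideanSpace ℝ (Fin m)) : ‖A.transpose.toEuclideanLin v‖ ≤ ‖A‖ * ‖v‖ := by
  rw [← Matrix.l2_opNorm_conjTranspose A, Matrix.conjTranspose_eq_transpose_of_trivial]
  exact Matrix.l2_opNorm_mulVec _ v

lemma norm_le_of_transpose_le (A : Matrix (Fin m) (Fin n) ℝ) {s : ℝ} (hs : 0 ≤ s)
    (h : ∀ v, ‖A.transpose.toEuclideanLin v‖ ≤ s * ‖v‖) : ‖A‖ ≤ s := by
  rw [← Matrix.l2_opNorm_conjTranspose A, Matrix.conjTranspose_eq_transpose_of_trivial,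
    Matrix.l2_opNorm_def]
  exact ContinuousLinearMap.opNorm_le_bound _ hs h

/-- A rank-one perturbation of norm `‖Aᵀ v‖` making the image orthogonal to the unit vector
`v`. -/
lemma exists_perturbation_orthogonal (A : Matrix (Fin m) (Fin n) ℝ)
    {v : EuclideanSpace ℝ (Fin m)} (hv : ‖v‖ = 1) :
    ∃ Δ : Matrix (Fin m) (Fin n) ℝ, v ∈ (imageSpace (A + Δ))ᗮ ∧
      ‖Δ‖ = ‖A.transpose.toEuclideanLin v‖ := by
  set g := A.transpose.toEuclideanLin v with hg
  -- For `Δ = -v gᵀ`, `(A + Δ)ᵀ v = g - ‖v‖² g = 0`.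
  refine ⟨-Matrix.vecMulVec v g, ?_, ?_⟩
  · have hΔ : ∀ x : EuclideanSpace ℝ (Fin n),
        (-Matrix.vecMulVec v g).toEuclideanLin x = -(⟪g, x⟫_ℝ • v) := by
      intro x
      ext i
      simp [Matrix.toLpLin_apply, Matrix.vecMulVec_mulVec,
        PiLp.inner_apply, dotProduct, mul_comm]
    rw [Submodule.mem_orthogonal']
    rintro _ ⟨x, rfl⟩
    rw [map_add, LinearMap.add_apply, hΔ, inner_add_right, inner_neg_right, inner_smul_right,
      real_inner_self_eq_norm_sq, hv, hg, inner_toEuclideanLin_transpose]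
    ring
  · have hΔ : ∀ w : EuclideanSpace ℝ (Fin m),
        (-Matrix.vecMulVec v g).transpose.toEuclideanLin w = -(⟪v, w⟫_ℝ • g) := by
      intro x
      ext i
      simp [Matrix.toLpLin_apply, Matrix.vecMulVec_mulVec,
        Matrix.transpose_vecMulVec, PiLp.inner_apply, dotProduct, mul_comm]
    refine le_antisymm (norm_le_of_transpose_le _ (norm_nonneg _) fun w => ?_) ?_
    · rw [hΔ, norm_neg, norm_smul, mul_comm]
      refine mul_le_mul_of_nonneg_left ?_ (norm_nonneg _)
      simpa [hv] using norm_inner_le_norm (𝕜 := ℝ) v w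
    · have h := norm_toEuclideanLin_transpose_le (-Matrix.vecMulVec v g) v
      rwa [hΔ, real_inner_self_eq_norm_sq, hv, one_pow, one_smul, norm_neg, mul_one] at h

/-- Renegar's distance is the least norm of `Aᵀ v` over the nonnegative unit vectors `v`. -/
lemma exists_renegarDist_eq (hm : 0 < m) (A : Matrix (Fin m) (Fin n) ℝ) :
    ∃ v ∈ nonnegSphere m, renegarDist A = ‖A.transpose.toEuclideanLin v‖ ∧
      ∀ w ∈ nonnegSphere m, renegarDist A ≤ ‖A.transpose.toEuclideanLin w‖ := by
  obtain ⟨v, hv, hmin⟩ := isCompact_nonnegSphere.exists_isMinOn (nonnegSphere_nonempty hm)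
    (f := fun v => ‖A.transpose.toEuclideanLin v‖)
    (LinearMap.continuous_of_finiteDimensional _).norm.continuousOn
  have hleast : renegarDist A = ‖A.transpose.toEuclideanLin v‖ := by
    refine IsLeast.csInf_eq ⟨?_, ?_⟩
    · obtain ⟨Δ, hΔ, hn⟩ := exists_perturbation_orthogonal A hv.1
      exact ⟨Δ, inter_posOrthant_eq_empty_of_orthogonal hv hΔ, hn.symm⟩
    · rintro _ ⟨Δ, hΔ, rfl⟩
      obtain ⟨w, hw, hwL⟩ := exists_mem_nonnegSphere_orthogonal hΔ
      refine (hmin hw).trans ?_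
      -- Normality of `w` reads `Aᵀ w = -Δᵀ w`, hence `‖Aᵀ w‖ ≤ ‖Δ‖`.
      rw [mem_orthogonal_imageSpace_iff, Matrix.transpose_add, map_add, LinearMap.add_apply,
        add_eq_zero_iff_eq_neg] at hwL
      have h := norm_toEuclideanLin_transpose_le Δ w
      rw [hw.1, mul_one] at h
      simpa only [hwL, norm_neg] using h
  exact ⟨v, hv, hleast, fun w hw => hleast.trans_le (hmin hw)⟩

/-- The residual `v - Π_L v` is orthogonal to the image, hence in the kernel of `Aᵀ`. -/
lemma toEuclideanLin_transpose_starProjection (A : Matrix (Fin m) (Fin n) ℝ)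
    (v : EuclideanSpace ℝ (Fin m)) :
    A.transpose.toEuclideanLin ((imageSpace A).starProjection v) =
      A.transpose.toEuclideanLin v := by
  have h := (mem_orthogonal_imageSpace_iff A _).1
    ((imageSpace A).sub_starProjection_mem_orthogonal v)
  rw [map_sub, sub_eq_zero] at h
  exact h.symm

lemma renegarDist_pos (hm : 0 < m) {A : Matrix (Fin m) (Fin n) ℝ}
    (hpos : ((imageSpace A : Set (EuclideanSpace ℝ (Fin m))) ∩ posOrthant m).Nonempty) :
    0 < renegarDist A := by
  obtain ⟨v, hv, heq, -⟩ := exists_renegarDist_eq hm A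
  rw [heq, norm_pos_iff]
  intro h
  exact hpos.ne_empty
    (inter_posOrthant_eq_empty_of_orthogonal hv ((mem_orthogonal_imageSpace_iff A v).2 h))

lemma grassmannCond_le (hm : 0 < m) {A : Matrix (Fin m) (Fin n) ℝ}
    (hpos : ((imageSpace A : Set (EuclideanSpace ℝ (Fin m))) ∩ posOrthant m).Nonempty)
    (hproper : imageSpace A ≠ ⊤) : grassmannCond A ≤ ‖A‖ / renegarDist A := by
  obtain ⟨v, hv, -, hleast⟩ := exists_isLeast_infeasibleDistances hm hproper
  obtain ⟨-, -, -, hR⟩ := exists_renegarDist_eq hm A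
  rw [grassmannCond, hleast.csInf_eq,
    div_le_div_iff₀ (norm_starProjection_pos hpos hv) (renegarDist_pos hm hpos), one_mul]
  refine (hR v hv).trans ?_
  rw [← toEuclideanLin_transpose_starProjection]
  exact norm_toEuclideanLin_transpose_le _ _

end Distances

/-! ### Orthonormal columns and nonsingular column changes -/

section OrthonormalColumns

variable {m n : ℕ} {A : Matrix (Fin m) (Fin n) ℝ}

lemma toEuclideanLin_transpose_apply (A : Matrix (Fin m) (Fin n) ℝ)
    (v : EuclideanSpace ℝ (Fin m)) (j : Fin n) :
    A.transpose.toEuclideanLin v j = ⟪(WithLp.toLp 2 (A.col j) : EuclideanSpace ℝ (Fin m)), v⟫_ℝ := by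
  simp [Matrix.toLpLin_apply, Matrix.mulVec, dotProduct, PiLp.inner_apply, mul_comm]

/-- If the nonzero columns of `A` are orthonormal, then `A Aᵀ` is the orthogonal projection onto
the image of `A`. -/
lemma toEuclideanLin_mul_transpose_eq_starProjection
    (h : Orthonormal ℝ (fun j : {j : Fin n // A.col j ≠ 0} =>
      (WithLp.toLp 2 (A.col j) : EuclideanSpace ℝ (Fin m)))) (v : EuclideanSpace ℝ (Fin m)) :
    A.toEuclideanLin (A.transpose.toEuclideanLin v) = (imageSpace A).starProjection v := by
  symm
  refine Submodule.eq_starProjection_of_mem_orthogonal ⟨_, rfl⟩ ?_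
  rw [mem_orthogonal_imageSpace_iff]
  set a : Fin n → EuclideanSpace ℝ (Fin m) := fun j => WithLp.toLp 2 (A.col j) with ha
  have hsum : ∀ x : EuclideanSpace ℝ (Fin n), A.toEuclideanLin x = ∑ j, x j • a j := by
    intro x
    ext i
    simp [Matrix.toLpLin_apply, Matrix.mulVec, dotProduct, ha, mul_comm]
  have hi : ∀ i j, i ≠ j → ⟪a i, a j⟫_ℝ = 0 := by
    intro i j hij
    by_cases h1 : A.col i = 0
    · simp [ha, h1]
    by_cases h2 : A.col j = 0
    · simp [ha, h2]
    exact h.2 (i := ⟨i, h1⟩) (j := ⟨j, h2⟩) (by simpa using hij)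
  ext i
  rw [toEuclideanLin_transpose_apply, inner_sub_right, hsum, inner_sum,
    Finset.sum_eq_single i (fun j _ hj => by
      change ⟪a i, _⟫_ℝ = 0
      rw [inner_smul_right, hi i j hj.symm, mul_zero]) (by simp)]
  change ⟪a i, v⟫_ℝ - ⟪a i, _⟫_ℝ = 0
  rw [inner_smul_right, toEuclideanLin_transpose_apply]
  change ⟪a i, v⟫_ℝ - ⟪a i, v⟫_ℝ * _ = 0
  -- What remains is `⟪a i, v⟫ (1 - ‖a i‖²)`: one factor vanishes whether the column is zero or a
  -- unit vector.
  by_cases h1 : A.col i = 0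
  · simp [ha, h1]
  · have : ‖a i‖ = 1 := h.1 ⟨i, h1⟩
    rw [real_inner_self_eq_norm_sq, this]
    ring

/-- `‖Aᵀ v‖² = ⟪v, A Aᵀ v⟫ = ⟪v, Π_L v⟫ = ‖Π_L v‖²`. -/
lemma norm_toEuclideanLin_transpose_eq
    (h : Orthonormal ℝ (fun j : {j : Fin n // A.col j ≠ 0} =>
      (WithLp.toLp 2 (A.col j) : EuclideanSpace ℝ (Fin m)))) (v : EuclideanSpace ℝ (Fin m)) :
    ‖A.transpose.toEuclideanLin v‖ = ‖(imageSpace A).starProjection v‖ := by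
  rw [← sq_eq_sq₀ (norm_nonneg _) (norm_nonneg _), ← real_inner_self_eq_norm_sq,
    ← real_inner_self_eq_norm_sq, inner_toEuclideanLin_transpose,
    toEuclideanLin_mul_transpose_eq_starProjection h,
    Submodule.inner_starProjection_left_eq_right,
    Submodule.starProjection_eq_self_iff.2 (Submodule.starProjection_apply_mem _ _)]

lemma norm_le_one_of_orthonormal
    (h : Orthonormal ℝ (fun j : {j : Fin n // A.col j ≠ 0} =>
      (WithLp.toLp 2 (A.col j) : EuclideanSpace ℝ (Fin m)))) : ‖A‖ ≤ 1 := by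
  refine norm_le_of_transpose_le _ zero_le_one fun v => ?_
  rw [norm_toEuclideanLin_transpose_eq h, one_mul]
  exact Submodule.norm_starProjection_apply_le _ _

lemma grassmannCond_eq_of_orthonormal (hm : 0 < m) (hproper : imageSpace A ≠ ⊤)
    (h : Orthonormal ℝ (fun j : {j : Fin n // A.col j ≠ 0} =>
      (WithLp.toLp 2 (A.col j) : EuclideanSpace ℝ (Fin m)))) :
    grassmannCond A = 1 / renegarDist A := by
  obtain ⟨v, hv, hmin, hleast⟩ := exists_isLeast_infeasibleDistances hm hproper
  obtain ⟨w, hw, hwR, hR⟩ := exists_renegarDist_eq hm A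
  rw [grassmannCond, hleast.csInf_eq]
  congr 1
  refine le_antisymm ?_ ?_
  · rw [hwR, norm_toEuclideanLin_transpose_eq h]
    exact hmin w hw
  · rw [← norm_toEuclideanLin_transpose_eq h]
    exact hR v hv

lemma toEuclideanLin_mul {l : ℕ} (A : Matrix (Fin m) (Fin n) ℝ) (B : Matrix (Fin n) (Fin l) ℝ) :
    (A * B).toEuclideanLin = A.toEuclideanLin ∘ₗ B.toEuclideanLin := by
  ext1 x
  simp [Matrix.toLpLin_apply, Matrix.mulVec_mulVec]

lemma imageSpace_mul_of_isUnit (A : Matrix (Fin m) (Fin n) ℝ) {R : Matrix (Fin n) (Fin n) ℝ}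
    (hR : IsUnit R) : imageSpace (A * R) = imageSpace A := by
  rw [imageSpace, imageSpace, toEuclideanLin_mul]
  refine LinearMap.range_comp_of_range_eq_top _ (LinearMap.range_eq_top.2 fun x => ?_)
  obtain ⟨S, hS⟩ := hR.exists_right_inv
  refine ⟨S.toEuclideanLin x, ?_⟩
  rw [← LinearMap.comp_apply, ← toEuclideanLin_mul, hS]
  simp

/-- Every matrix can be multiplied by a nonsingular matrix on the right so that the nonzero
columns of the product are orthonormal. -/
lemma exists_isUnit_orthonormal_mul (A : Matrix (Fin m) (Fin n) ℝ) :
    ∃ R : Matrix (Fin n) (Fin n) ℝ, IsUnit R ∧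
      Orthonormal ℝ (fun j : {j : Fin n // (A * R).col j ≠ 0} =>
        (WithLp.toLp 2 ((A * R).col j) : EuclideanSpace ℝ (Fin m))) := by
  set f := A.toEuclideanLin with hf
  let u := stdOrthonormalBasis ℝ f.range
  -- A basis of the kernel completed by preimages of an orthonormal basis `u` of the range. With its
  -- vectors as columns of `R`, each column of `A R` is zero or a distinct `u i`.
  let b₀ := Module.Basis.sumQuot (Module.finBasis ℝ f.ker)
    (u.toBasis.map f.quotKerEquivRange.symm)
  have hcard := Module.finrank_eq_card_basis b₀
  rw [finrank_euclideanSpace] at hcard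
  let e := Fintype.equivOfCardEq hcard
  let b := b₀.reindex e.symm
  have hinl : ∀ j i, e j = Sum.inl i → f (b j) = 0 := by
    intro j i hj
    have : b j = Module.finBasis ℝ f.ker i := by
      simp only [b, Module.Basis.reindex_apply, Equiv.symm_symm, hj]
      exact Module.Basis.sumQuot_inl _ _ i
    rw [this]
    exact (Module.finBasis ℝ f.ker i).2
  have hinr : ∀ j i, e j = Sum.inr i → f (b j) = u i := by
    intro j i hj
    have h1 : f.ker.mkQ (b j) = f.quotKerEquivRange.symm (u i) := by
      simp only [b, Module.Basis.reindex_apply, Equiv.symm_symm, hj]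
      refine (Module.Basis.sumQuot_inr (Module.finBasis ℝ f.ker)
        (u.toBasis.map f.quotKerEquivRange.symm) i).trans ?_
      rw [Module.Basis.map_apply, OrthonormalBasis.coe_toBasis]
    have h2 := congrArg f.quotKerEquivRange h1
    rw [LinearEquiv.apply_symm_apply] at h2
    rw [← h2]
    rfl
  let c := (EuclideanSpace.basisFun (Fin n) ℝ).toBasis
  refine ⟨c.toMatrix b, ?_, ?_⟩
  · have := c.invertibleToMatrix b
    exact isUnit_of_invertible _
  · have hcol : ∀ j, (WithLp.toLp 2 ((A * c.toMatrix b).col j) : EuclideanSpace ℝ (Fin m)) =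
        f (b j) := by
      intro j
      ext i
      simp [hf, c, Matrix.toLpLin_apply, Matrix.mul_apply, Matrix.mulVec, dotProduct,
        Module.Basis.toMatrix_apply]
    have hex : ∀ j : {j : Fin n // (A * c.toMatrix b).col j ≠ 0}, ∃ i, e j = Sum.inr i := by
      rintro ⟨j, hj⟩
      rcases hej : e j with i | i
      · refine absurd ?_ hj
        have h := hcol j
        rw [hinl j i hej] at h
        simpa using h
      · exact ⟨i, rfl⟩
    choose g hg using hex
    have hginj : Function.Injective g := by
      intro j k hjk
      exact Subtype.ext (e.injective (by rw [hg j, hg k, hjk]))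
    have horth : Orthonormal ℝ fun i => (u i : EuclideanSpace ℝ (Fin m)) :=
      u.orthonormal.comp_linearIsometry f.range.subtypeₗᵢ
    convert horth.comp g hginj using 1
    ext1 j
    rw [hcol, hinr j _ (hg j)]
    rfl

end OrthonormalColumns

theorem proposition6 {m n : ℕ} (A : Matrix (Fin m) (Fin n) ℝ) (hA : A ≠ 0)
    (hpos : ((imageSpace A : Set (EuclideanSpace ℝ (Fin m))) ∩ posOrthant m).Nonempty)
    (hproper : imageSpace A ≠ ⊤) :
    -- the quantities involved are well defined: the denominators are positive and the minimum
    -- in the definition of the Grassmannian condition number is attained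
    0 < renegarDist A ∧
    0 < sInf (infeasibleDistances (imageSpace A)) ∧
    sInf (infeasibleDistances (imageSpace A)) ∈ infeasibleDistances (imageSpace A) ∧
    -- the inequality
    grassmannCond A ≤ ‖A‖ / renegarDist A ∧
    -- equality when the nonzero columns of `A` are orthonormal
    (Orthonormal ℝ (fun j : {j : Fin n // A.col j ≠ 0} =>
        (WithLp.toLp 2 (A.col j) : EuclideanSpace ℝ (Fin m))) →
      grassmannCond A = 1 / renegarDist A) ∧
    -- the variational identity, with the minimum attained
    IsLeast {c : ℝ | ∃ R : Matrix (Fin n) (Fin n) ℝ,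
        IsUnit R ∧ c = ‖A * R‖ / renegarDist (A * R)}
      (grassmannCond A) := by
  -- For `m = 0` there are no unit vectors to minimise over; `A ≠ 0` rules this out.
  have hm : 0 < m := by
    rcases Nat.eq_zero_or_pos m with rfl | h
    · exact absurd (Subsingleton.elim _ _) hA
    · exact h
  obtain ⟨v, hv, -, hleast⟩ := exists_isLeast_infeasibleDistances hm hproper
  have hle : ∀ R : Matrix (Fin n) (Fin n) ℝ, IsUnit R →
      grassmannCond A ≤ ‖A * R‖ / renegarDist (A * R) := by
    intro R hR
    have him := imageSpace_mul_of_isUnit A hR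
    have h := grassmannCond_le hm (A := A * R) (by rwa [him]) (by rwa [him])
    rwa [grassmannCond, him] at h
  refine ⟨renegarDist_pos hm hpos, ?_, ?_, grassmannCond_le hm hpos hproper,
    grassmannCond_eq_of_orthonormal hm hproper, ?_, ?_⟩
  · rw [hleast.csInf_eq]
    exact norm_starProjection_pos hpos hv
  · rw [hleast.csInf_eq]
    exact hleast.1
  · obtain ⟨R, hR, horth⟩ := exists_isUnit_orthonormal_mul A
    have him := imageSpace_mul_of_isUnit A hR
    refine ⟨R, hR, (hle R hR).antisymm ?_⟩
    have h := grassmannCond_eq_of_orthonormal hm (by rwa [him]) horth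
    rw [grassmannCond, him] at h
    rw [grassmannCond, h]
    -- `‖A R‖ ≤ 1` suffices, since `hle` already gives the opposite inequality.
    exact div_le_div_of_nonneg_right (norm_le_one_of_orthonormal horth)
      (renegarDist_pos hm (by rwa [him])).le
  · rintro _ ⟨R, hR, rfl⟩
    exact hle R hR
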